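/- Let $R$ be a complete discrete valuation ring with fraction field $K$ and finite residue field of cardinality $q$, and let $v_R$ be the valuation of $R$, normalized to take the value $1$ on a uniformizer and extended to $K$. Let $d\ge 1$ be an integer, let $\Omega = M_d(R)$ be the group of $d\times d$ matrices over $R$, and let $\mathbb P$ be the Haar probability measure on the compact additive group $\Omega$. An LU decomposition of $\omega\in\Omega$ is a factorization $\omega = L(\omega)\,U(\omega)$ with $L(\omega)$ unit lower triangular and $U(\omega)$ upper triangular, both with entries in $K$. Then $\mathbb P$-almost every $\omega\in\Omega$ admits exactly one LU decomposition. Let $V_L(\omega)$ denote the opposite of the smallest valuation of an entry of $L(\omega)$, i.e. $V_L(\omega) = -\min_{i,j} v_R(L(\omega)_{i,j})$. Then, for every real number $\ell>0$, $$\mathbb P\Big[\,\big|V_L - \big(\log_q d - \tfrac12\big)\big| > \ell + \tfrac12\,\Big] \;\le\; \frac{q}{q-1}\cdot q^{-\ell}\cdot\big(2+\ell\cdot\log q\big),$$ where $\log$ is the natural logarithm and $\log_q d = \log d/\log q$. -/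

import Mathlib

namespace RandomLU

open Matrix

/-- `IsLU M L U`: `M = L * U` is an LU decomposition of the square matrix `M` over the field `K`,
with `L` unit lower triangular and `U` upper triangular, both with entries in `K`. -/
structure IsLU {K : Type*} [Field K] {d : ℕ} (M L U : Matrix (Fin d) (Fin d) K) : Prop where
  diag_one : ∀ i, L i i = 1
  lower : ∀ i j, i < j → L i j = 0
  upper : ∀ i j, j < i → U i j = 0
  mul_eq : M = L * U

open Classical in
/-- The partially defined function `M ↦ L(M)`: the `L`-part of an LU decomposition of `M`
(with the value `1` when `M` has no LU decomposition). -/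
noncomputable def lPart {K : Type*} [Field K] {d : ℕ} (M : Matrix (Fin d) (Fin d) K) :
    Matrix (Fin d) (Fin d) K :=
  if h : ∃ L U, IsLU M L U then h.choose else 1

/-- The opposite of the smallest valuation of an entry of `L`, for a matrix `L` over the fraction
field `K` of the discrete valuation ring `R`. The valuation on `K` is written multiplicatively, so
that `x ≠ 0` of additive valuation `n` is sent to `exp (-n)` and `0` is sent to `0`; hence the
largest multiplicative valuation of an entry is `exp (-m)`, with `m` the smallest additive one. -/
noncomputable def negMinVal (R : Type*) [CommRing R] [IsDomain R] [IsDiscreteValuationRing R]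
    {K : Type*} [Field K] [Algebra R K] [IsFractionRing R K] {d : ℕ}
    (L : Matrix (Fin d) (Fin d) K) : ℤ :=
  WithZero.log (Finset.univ.sup fun p : Fin d × Fin d =>
    (IsDiscreteValuationRing.maximalIdeal R).valuation K (L p.1 p.2))

/-- The random variable `V_L` on `d × d` matrices over `R`: the opposite of the smallest valuation
of an entry of the `L`-part, over the fraction field `K`, of `ω`. -/
noncomputable def VL {R : Type*} [CommRing R] [IsDomain R] [IsDiscreteValuationRing R]
    (K : Type*) [Field K] [Algebra R K] [IsFractionRing R K] {d : ℕ}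
    (ω : Matrix (Fin d) (Fin d) R) : ℤ :=
  negMinVal R (lPart (ω.map (algebraMap R K)))

end RandomLU

/-!
For a column index `j`, let `φ_j` (`minorForm ω j`) be the linear form sending a row `r` to the
leading minor of size `j + 1` of `ω` in which row `j` has been replaced by `r`. It depends only on
the rows of `ω` above row `j`, and Cramer's rule (`IsLU.minorForm_row`) says that the `L`-part of
`ω` satisfies `L i j * φ_j (ω j) = φ_j (ω i)`. In particular `ω` has exactly one LU decomposition
as soon as its leading minors `φ_j (ω j)` do not vanish.

Let `c_j` be the content of `φ_j`, that is, the smallest valuation of its values. The form `φ_j`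
divided by `ϖ ^ c_j` is surjective, so for `i ≥ j` its value at row `i` is uniformly distributed in
`R`, even conditionally on all the other rows. This is `measureReal_inter_minorEvent`; it only uses
the invariance of Haar measure, by averaging over finitely many translations of row `i`. Write
`A_j` for the event that `φ_j (ω j)` has valuation at least `c_j + v`; in that case pivot `j` is
called deep. The events `A_j` are independent of probability `q ^ (-v)`. Letting `v` grow, one sees
that the leading minors are almost surely nonzero.

* Upper tail: if `V_L ≥ v`, some `A_j` holds, an event of probability at most `d * q ^ (-v)`.
* Lower tail: suppose `V_L < v`. If `A_j` holds then all the values `φ_j (ω i)` with `i > j` have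
  valuation larger than `c_j`, since otherwise `L i j` would be too large. Given `A_j`, this has
  probability `q ^ (-(d - 1 - j))`. Hence, for every `n ≤ d`, the probability of `V_L < v` is at
  most `(1 - q ^ (-v)) ^ n + ∑ j < n, q ^ (-v) * q ^ (-(d - 1 - j))`. Taking `n = d - ⌈ℓ⌉` makes
  both terms `O (q ^ (-ℓ))` (`lower_tail_le`).

The two tails together contribute at most `q ^ (-ℓ) * (1 + q / (q - 1))`, which is below the claimed
bound.
-/

namespace RandomLU

open Matrix

/-! ### Leading minors and LU decompositions -/

/-- The `n`-th leading principal minor of a square matrix. -/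
def leadingMinor {S : Type*} [CommRing S] {d : ℕ} (A : Matrix (Fin d) (Fin d) S) {n : ℕ}
    (h : n ≤ d) : S :=
  (A.submatrix (Fin.castLE h) (Fin.castLE h)).det

/-- The linear form sending a row `r` to the leading principal minor of size `j + 1` of the matrix
obtained from `A` by replacing its row `j` by `r`. It depends only on the rows of `A` above
row `j`. -/
def minorForm {S : Type*} [CommRing S] {d : ℕ} (A : Matrix (Fin d) (Fin d) S) (j : Fin d) :
    (Fin d → S) →ₗ[S] S :=
  LinearMap.proj (Fin.last (j : ℕ)) ∘ₗ
    Matrix.cramer (A.submatrix (Fin.castLE j.isLt) (Fin.castLE j.isLt))ᵀ ∘ₗ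
      LinearMap.funLeft S S (Fin.castLE j.isLt)

section CommRing

variable {S : Type*} [CommRing S] {d : ℕ}

theorem minorForm_apply (A : Matrix (Fin d) (Fin d) S) (j : Fin d) (r : Fin d → S) :
    minorForm A j r = ((A.submatrix (Fin.castLE j.isLt) (Fin.castLE j.isLt)).updateRow
      (Fin.last (j : ℕ)) (r ∘ Fin.castLE j.isLt)).det := by
  simp only [minorForm, LinearMap.comp_apply, LinearMap.proj_apply]
  rw [cramer_transpose_apply]
  rfl

theorem castLE_last (j : Fin d) :
    Fin.castLE j.isLt (Fin.last (j : ℕ)) = j := by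
  ext; simp

theorem minorForm_self (A : Matrix (Fin d) (Fin d) S) (j : Fin d) :
    minorForm A j (A j) = leadingMinor A (n := j + 1) j.isLt := by
  rw [minorForm_apply, leadingMinor]
  congr 1
  ext a b
  by_cases h : a = Fin.last (j : ℕ)
  · subst h
    simp [castLE_last]
  · simp [updateRow_ne h]

/-- In particular `minorForm A j` is nonzero when the leading minor of size `j` is. -/
theorem minorForm_single (A : Matrix (Fin d) (Fin d) S) (j : Fin d) :
    minorForm A j (Pi.single j 1) = leadingMinor A j.isLt.le := by
  have h1 : (Pi.single j (1 : S) : Fin d → S) ∘ Fin.castLE j.isLt =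
      Pi.single (Fin.last (j : ℕ)) 1 := by
    ext a
    simp only [Function.comp_apply, Pi.single_apply]
    congr 1
    simp [Fin.ext_iff]
  rw [minorForm_apply, h1, ← adjugate_apply, adjugate_fin_succ_eq_det_submatrix, leadingMinor,
    Fin.succAbove_last, submatrix_submatrix]
  simp [← two_mul]

theorem minorForm_congr {A B : Matrix (Fin d) (Fin d) S} {j : Fin d} (h : ∀ a < j, A a = B a) :
    minorForm A j = minorForm B j := by
  ext r
  simp only [LinearMap.comp_apply, minorForm_apply]
  congr 1
  ext a b
  by_cases ha : a = Fin.last (j : ℕ)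
  · subst ha; simp
  · have : Fin.castLE j.isLt a < j := by
      have := a.isLt
      have h2 : (a : ℕ) ≠ j := fun h => ha (Fin.ext h)
      rw [Fin.lt_def]
      simp only [Fin.val_castLE]
      omega
    simp [updateRow_ne ha, h _ this]

theorem minorForm_map {T : Type*} [CommRing T] (f : S →+* T) (A : Matrix (Fin d) (Fin d) S)
    (j : Fin d) (r : Fin d → S) :
    minorForm (A.map f) j (f ∘ r) = f (minorForm A j r) := by
  rw [minorForm_apply, minorForm_apply, RingHom.map_det]
  congr 1
  ext a b
  by_cases ha : a = Fin.last (j : ℕ)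
  · subst ha; simp
  · simp [updateRow_ne ha]

theorem leadingMinor_map {T : Type*} [CommRing T] (f : S →+* T) (A : Matrix (Fin d) (Fin d) S)
    {n : ℕ} (h : n ≤ d) : leadingMinor (A.map f) h = f (leadingMinor A h) := by
  rw [leadingMinor, leadingMinor, RingHom.map_det]
  rfl

/-- Truncating `L * U` to the first `j + 1` columns only involves the first `j + 1` columns of `L`
and the upper left corner of `U`, when `U` is upper triangular. -/
theorem mul_apply_castLE {L U : Matrix (Fin d) (Fin d) S} (hU : ∀ i j, j < i → U i j = 0)
    (j i : Fin d) (b : Fin (j + 1)) :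
    (L * U) i (Fin.castLE j.isLt b) =
      ∑ k : Fin (j + 1), L i (Fin.castLE j.isLt k) *
        U (Fin.castLE j.isLt k) (Fin.castLE j.isLt b) := by
  rw [mul_apply]
  symm
  refine Fintype.sum_of_injective (Fin.castLE j.isLt) (Fin.castLE_injective _) _ _ ?_
    fun k => rfl
  intro k hk
  rw [hU, mul_zero]
  by_contra hlt
  refine hk ⟨⟨k, ?_⟩, rfl⟩
  have := b.isLt
  simp only [Fin.lt_def, Fin.val_castLE] at hlt
  omega

theorem minorForm_mul_row {L U : Matrix (Fin d) (Fin d) S} (h1 : ∀ i, L i i = 1)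
    (hL : ∀ i j, i < j → L i j = 0) (hU : ∀ i j, j < i → U i j = 0) (j i : Fin d) :
    minorForm (L * U) j ((L * U) i) = L i j * leadingMinor U (n := j + 1) j.isLt := by
  have key : ((L * U).submatrix (Fin.castLE j.isLt) (Fin.castLE j.isLt)).updateRow
      (Fin.last (j : ℕ)) ((L * U) i ∘ Fin.castLE j.isLt) =
      ((L.submatrix (Fin.castLE j.isLt) (Fin.castLE j.isLt)).updateRow
        (Fin.last (j : ℕ)) (L i ∘ Fin.castLE j.isLt)) *
        U.submatrix (Fin.castLE j.isLt) (Fin.castLE j.isLt) := by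
    ext a b
    by_cases ha : a = Fin.last (j : ℕ)
    · subst ha
      simp [mul_apply_castLE hU j, mul_apply (M := updateRow _ _ _)]
    · simp [updateRow_ne ha, mul_apply_castLE hU j, mul_apply (M := updateRow _ _ _)]
  rw [minorForm_apply, key, det_mul, leadingMinor]
  congr 1
  rw [det_of_isLowerTriangular]
  · rw [Fin.prod_univ_castSucc, Finset.prod_eq_one, one_mul]
    · simp [castLE_last]
    · intro a _
      rw [updateRow_ne (Fin.castSucc_lt_last a).ne]
      exact h1 _
  · intro a b hab
    have hab' : a < b := hab
    have ha : a ≠ Fin.last (j : ℕ) := (hab'.trans_le (Fin.le_last b)).ne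
    rw [updateRow_ne ha]
    exact hL _ _ hab'

end CommRing

section Field

variable {K : Type*} [Field K] {d : ℕ} {M : Matrix (Fin d) (Fin d) K}

/-- The entries of the `L`-part are quotients of minors. -/
theorem IsLU.minorForm_row {L U : Matrix (Fin d) (Fin d) K} (h : IsLU M L U) (j i : Fin d) :
    minorForm M j (M i) = L i j * minorForm M j (M j) := by
  rw [h.mul_eq, minorForm_mul_row h.diag_one h.lower h.upper,
    minorForm_mul_row h.diag_one h.lower h.upper, h.diag_one, one_mul]

theorem det_eq_one_of_unitLower {L : Matrix (Fin d) (Fin d) K} (h1 : ∀ i, L i i = 1)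
    (hL : ∀ i j, i < j → L i j = 0) : L.det = 1 := by
  rw [det_of_isLowerTriangular _ fun i j hij => hL i j hij]
  simp [h1]

theorem IsLU.unique {L U L' U' : Matrix (Fin d) (Fin d) K} (h : IsLU M L U) (h' : IsLU M L' U')
    (hM : ∀ j : Fin d, minorForm M j (M j) ≠ 0) : L = L' ∧ U = U' := by
  have hL : L = L' := by
    ext i j
    exact mul_right_cancel₀ (hM j) ((h.minorForm_row j i).symm.trans (h'.minorForm_row j i))
  refine ⟨hL, ?_⟩
  subst hL
  have hu : IsUnit L := by
    rw [isUnit_iff_isUnit_det, det_eq_one_of_unitLower h.diag_one h.lower]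
    exact isUnit_one
  exact hu.mul_left_cancel (h.mul_eq.symm.trans h'.mul_eq)

/-- The rows of the inverse of the `L`-part. -/
theorem exists_row_combination (hM : ∀ (n : ℕ) (h : n ≤ d), leadingMinor M h ≠ 0) (i : Fin d) :
    ∃ r : Fin d → K, r i = 1 ∧ (∀ k, i < k → r k = 0) ∧ ∀ b, b < i → (r ᵥ* M) b = 0 := by
  -- Row `i` is corrected by the combination of the rows above it that has the same first `i`
  -- entries; it exists because the leading block of size `i` is invertible.
  set c := Fin.castLE i.isLt.le with hc
  set B := M.submatrix c c with hB
  have hBdet : IsUnit B.det := isUnit_iff_ne_zero.2 (hM i i.isLt.le)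
  set x : Fin i → K := (M i ∘ c) ᵥ* B⁻¹ with hx
  have hxB : x ᵥ* B = M i ∘ c := by
    rw [hx, vecMul_vecMul, nonsing_inv_mul _ hBdet, vecMul_one]
  refine ⟨fun k => if h : k < i then - x ⟨k, h⟩ else if k = i then 1 else 0, ?_, ?_, ?_⟩
  · simp
  · intro k hk
    simp [hk.not_gt, hk.ne']
  · intro b hb
    have h1 := congrFun hxB ⟨b, hb⟩
    have h2 : ∑ k : Fin i, x k * M (c k) b = M i b := h1
    rw [vecMul, dotProduct, ← Finset.sum_filter_add_sum_filter_not _ (fun k => k < i)]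
    have h3 : ∑ k with k < i, (if h : k < i then - x ⟨k, h⟩ else if k = i then 1 else 0) * M k b =
        - ∑ k : Fin i, x k * M (c k) b := by
      rw [Finset.sum_filter, ← Finset.sum_neg_distrib]
      symm
      refine Fintype.sum_of_injective c (Fin.castLE_injective _) _ _ ?_ ?_
      · intro k hk
        rw [if_neg]
        exact fun hlt => hk ⟨⟨k, hlt⟩, rfl⟩
      · intro k
        have : c k < i := k.isLt
        simp only [this, if_true, dite_true, neg_mul]
        rfl
    rw [h3, h2, Finset.sum_eq_single i]
    · simp
    · intro k hk hki
      simp only [Finset.mem_filter] at hk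
      simp [hk.2, hki]
    · simp

theorem exists_isLU (hM : ∀ (n : ℕ) (h : n ≤ d), leadingMinor M h ≠ 0) :
    ∃ L U, IsLU M L U := by
  choose r hr1 hr2 hr3 using exists_row_combination hM
  set N : Matrix (Fin d) (Fin d) K := of r with hN
  have hdet : N.det = 1 := det_eq_one_of_unitLower hr1 hr2
  have hu : IsUnit N.det := by rw [hdet]; exact isUnit_one
  let _ : Invertible N := invertibleOfIsUnitDet N hu
  have hinv : ∀ i j, i < j → N⁻¹ i j = 0 := fun i j hij =>
    blockTriangular_inv_of_blockTriangular (M := N) (b := OrderDual.toDual)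
      (fun a b hab => hr2 a b hab) hij
  refine ⟨N⁻¹, N * M, fun i => ?_, hinv, fun i j hij => ?_, ?_⟩
  · have h1 : (N * N⁻¹) i i = 1 := by rw [mul_nonsing_inv _ hu, one_apply_eq]
    rw [mul_apply, Finset.sum_eq_single i] at h1
    · rwa [show N i i = 1 from hr1 i, one_mul] at h1
    · intro k _ hk
      rcases lt_or_gt_of_ne hk with h | h
      · rw [hinv k i h, mul_zero]
      · rw [show N i k = 0 from hr2 i k h, zero_mul]
    · simp
  · exact hr3 i j hij
  · rw [← mul_assoc, nonsing_inv_mul _ hu, one_mul]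

end Field

/-! ### Averaging over translations -/

section Averaging

open MeasureTheory

/-- If `E` is stable under finitely many translations and, for almost every point of `E`, a
proportion `1 / n` of these translations sends it into `F`, then `F` has conditional
probability `1 / n` given `E`. -/
theorem mul_measure_inter_eq_of_translations {Ω : Type*} [AddGroup Ω] [MeasurableSpace Ω]
    [MeasurableAdd Ω] (μ : Measure Ω) [μ.IsAddLeftInvariant] {ι : Type*} [Finite ι]
    [Nonempty ι] (t : ι → Ω) {E F : Set Ω} (hE : MeasurableSet E) (hF : MeasurableSet F)
    (hinv : ∀ a ω, t a + ω ∈ E ↔ ω ∈ E) (n : ℕ)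
    (hcount : ∀ᵐ ω ∂μ, n * Nat.card {a // t a + ω ∈ F} = Nat.card ι) :
    n * μ (E ∩ F) = μ E := by
  classical
  cases nonempty_fintype ι
  have hmeas : ∀ a, MeasurableSet ((fun ω => t a + ω) ⁻¹' (E ∩ F)) := fun a =>
    (measurable_const_add (t a)) (hE.inter hF)
  have h1 : (Fintype.card ι : ENNReal) * μ (E ∩ F) =
      ∫⁻ ω, ∑ a, ((fun ω => t a + ω) ⁻¹' (E ∩ F)).indicator 1 ω ∂μ := by
    rw [lintegral_finsetSum _ fun a _ => measurable_one.indicator (hmeas a)]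
    simp_rw [lintegral_indicator_one (hmeas _), measure_preimage_add]
    simp
  have h2 : (n : ENNReal) * ∫⁻ ω, ∑ a, ((fun ω => t a + ω) ⁻¹' (E ∩ F)).indicator 1 ω ∂μ =
      Fintype.card ι * μ E := by
    rw [← lintegral_const_mul _ (Finset.measurable_sum _ fun a _ =>
      measurable_one.indicator (hmeas a)), ← lintegral_indicator_one hE,
      ← lintegral_const_mul _ (measurable_one.indicator hE)]
    refine lintegral_congr_ae ?_
    filter_upwards [hcount] with ω hω
    by_cases hωE : ω ∈ E
    · have h3 : ∀ a, ((fun ω => t a + ω) ⁻¹' (E ∩ F)).indicator (1 : Ω → ENNReal) ω =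
          if t a + ω ∈ F then 1 else 0 := by
        intro a
        simp [Set.indicator_apply, hinv, hωE]
      simp_rw [h3]
      rw [Finset.sum_boole, Set.indicator_of_mem hωE, Pi.one_apply, mul_one,
        ← Fintype.card_subtype, ← Nat.card_eq_fintype_card, ← Nat.card_eq_fintype_card, ← hω,
        Nat.cast_mul]
    · simp [hinv, hωE]
  rw [← h1, mul_left_comm] at h2
  exact (ENNReal.mul_right_inj (by simp) (by simp)).1 h2

end Averaging

/-! ### Linear forms over a discrete valuation ring -/

section DVR

open IsLocalRing

variable {R : Type*} [CommRing R] [IsDomain R] [IsDiscreteValuationRing R]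

theorem finite_quotient_maximalIdeal_pow [Finite (ResidueField R)] (v : ℕ) :
    Finite (R ⧸ maximalIdeal R ^ v) := by
  have : Finite (R ⧸ maximalIdeal R) := ‹Finite (ResidueField R)›
  exact Ideal.finite_quotient_pow (IsNoetherian.noetherian _) v

theorem card_quotient_maximalIdeal_pow (v : ℕ) :
    Nat.card (R ⧸ maximalIdeal R ^ v) = Nat.card (ResidueField R) ^ v :=
  cardQuot_pow_of_prime (IsDiscreteValuationRing.not_a_field R)

/-- A nonzero linear form is `ϖ ^ m` times a surjective one, which is equidistributed modulo every
power of the maximal ideal. -/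
theorem card_pow_mul_card_linearForm_mem [Finite (ResidueField R)] {d : ℕ}
    {f : (Fin d → R) →ₗ[R] R} (hf : f ≠ 0) (v : ℕ) (x : Fin d → R) :
    Nat.card (ResidueField R) ^ v * Nat.card {a : Fin d → R ⧸ maximalIdeal R ^ v //
      ∀ s, (∀ r, f r ∈ maximalIdeal R ^ s) →
        f ((fun k => (a k).out) + x) ∈ maximalIdeal R ^ (s + v)} =
      Nat.card (Fin d → R ⧸ maximalIdeal R ^ v) := by
  classical
  have := finite_quotient_maximalIdeal_pow (R := R) v
  obtain ⟨ϖ, hϖ⟩ := IsDiscreteValuationRing.exists_irreducible R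
  have hmem : ∀ (n : ℕ) (y : R), y ∈ maximalIdeal R ^ n ↔ ϖ ^ n ∣ y := fun n y => by
    rw [hϖ.maximalIdeal_eq, Ideal.span_singleton_pow, Ideal.mem_span_singleton]
  obtain ⟨m, hm⟩ := IsDiscreteValuationRing.ideal_eq_span_pow_irreducible
    (s := LinearMap.range f) (by rwa [ne_eq, LinearMap.range_eq_bot]) hϖ
  have hϖm : ϖ ^ m ≠ 0 := pow_ne_zero _ hϖ.ne_zero
  have hdvd : ∀ r, ϖ ^ m ∣ f r := fun r => by
    rw [← Ideal.mem_span_singleton, ← hm]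
    exact LinearMap.mem_range_self f r
  obtain ⟨r₀, hr₀⟩ : ∃ r, f r = ϖ ^ m := by
    have : ϖ ^ m ∈ LinearMap.range f := hm ▸ Ideal.mem_span_singleton_self _
    exact this
  choose g hg using hdvd
  -- The quotient of `f` by `ϖ ^ m`, reduced modulo the `v`-th power of the maximal ideal.
  let Φ : (Fin d → R ⧸ maximalIdeal R ^ v) →+ R ⧸ maximalIdeal R ^ v :=
    { toFun := fun a => ∑ k, a k * Ideal.Quotient.mk _ (g (Pi.single k 1))
      map_zero' := by simp
      map_add' := fun a b => by simp [add_mul, Finset.sum_add_distrib] }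
  have hΦ : ∀ r : Fin d → R, Φ (fun k => Ideal.Quotient.mk _ (r k)) =
      Ideal.Quotient.mk _ (g r) := by
    intro r
    have h1 : g r = ∑ k, r k * g (Pi.single k 1) := by
      apply mul_left_cancel₀ hϖm
      rw [← hg, Finset.mul_sum]
      conv_lhs => rw [pi_eq_sum_univ' r]
      rw [map_sum]
      refine Finset.sum_congr rfl fun k _ => ?_
      rw [map_smul, hg, smul_eq_mul]
      ring
    simp [Φ, h1]
  have hΦadd : ∀ (a : Fin d → R ⧸ maximalIdeal R ^ v),
      (∀ s, (∀ r, f r ∈ maximalIdeal R ^ s) →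
        f ((fun k => (a k).out) + x) ∈ maximalIdeal R ^ (s + v)) ↔
      Φ a = - Φ (fun k => Ideal.Quotient.mk _ (x k)) := by
    intro a
    have h1 : (∀ s, (∀ r, f r ∈ maximalIdeal R ^ s) →
        f ((fun k => (a k).out) + x) ∈ maximalIdeal R ^ (s + v)) ↔
        g ((fun k => (a k).out) + x) ∈ maximalIdeal R ^ v := by
      rw [hmem]
      constructor
      · intro h
        have h2 := h m fun r => (hmem _ _).2 (hg r ▸ dvd_mul_right _ _)
        rw [hmem, hg, pow_add] at h2
        exact (mul_dvd_mul_iff_left hϖm).1 h2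
      · intro h s hs
        have h3 : s ≤ m := by
          have h4 := hs r₀
          rw [hr₀, hmem] at h4
          exact (pow_dvd_pow_iff hϖ.ne_zero hϖ.not_isUnit).1 h4
        rw [hmem, hg, pow_add]
        exact mul_dvd_mul (pow_dvd_pow _ h3) h
    rw [h1, ← Ideal.Quotient.eq_zero_iff_mem, ← hΦ, eq_neg_iff_add_eq_zero, ← map_add]
    have h5 : (fun k => Ideal.Quotient.mk (maximalIdeal R ^ v) (((fun k => (a k).out) + x) k)) =
        a + fun k => Ideal.Quotient.mk _ (x k) := by
      ext k
      simp only [Pi.add_apply, map_add]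
      congr 1
      exact Quotient.out_eq _
    rw [h5]
  have hsurj : Function.Surjective Φ := by
    intro c
    obtain ⟨y, rfl⟩ := Ideal.Quotient.mk_surjective c
    refine ⟨fun k => Ideal.Quotient.mk _ ((y • r₀) k), ?_⟩
    rw [hΦ]
    congr 1
    apply mul_left_cancel₀ hϖm
    rw [← hg, map_smul, hr₀, smul_eq_mul, mul_comm]
  simp_rw [hΦadd]
  cases nonempty_fintype (R ⧸ maximalIdeal R ^ v)
  have hfib : Fintype.card (Fin d → R ⧸ maximalIdeal R ^ v) = _ :=
    Finset.card_eq_sum_card_fiberwise (f := Φ) (t := Finset.univ) fun _ _ => Finset.mem_univ _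
  rw [← card_quotient_maximalIdeal_pow, Nat.card_eq_fintype_card, Nat.card_eq_fintype_card,
    Nat.card_eq_fintype_card, Fintype.card_subtype, hfib,
    Finset.sum_congr rfl fun c _ => AddMonoidHom.card_fiber_eq_of_mem_range Φ
      (hsurj c) (hsurj (- Φ (fun k => Ideal.Quotient.mk _ (x k))))]
  simp

end DVR

/-! ### Divisibility events -/

section RowInvariant

variable {R : Type*} [CommRing R] {d : ℕ}

/-- A set of matrices whose membership condition does not involve row `i`. -/
def RowInvariant (E : Set (Matrix (Fin d) (Fin d) R)) (i : Fin d) :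
    Prop :=
  ∀ (r : Fin d → R) (ω : Matrix (Fin d) (Fin d) R),
    updateRow (0 : Matrix (Fin d) (Fin d) R) i r + ω ∈ E ↔ ω ∈ E

theorem RowInvariant.inter {E F : Set (Matrix (Fin d) (Fin d) R)} {i : Fin d}
    (hE : RowInvariant E i) (hF : RowInvariant F i) : RowInvariant (E ∩ F) i :=
  fun r ω => and_congr (hE r ω) (hF r ω)

theorem RowInvariant.diff {E F : Set (Matrix (Fin d) (Fin d) R)} {i : Fin d}
    (hE : RowInvariant E i) (hF : RowInvariant F i) : RowInvariant (E \ F) i :=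
  fun r ω => and_congr (hE r ω) (not_congr (hF r ω))

theorem rowInvariant_univ (i : Fin d) :
    RowInvariant (Set.univ : Set (Matrix (Fin d) (Fin d) R)) i :=
  fun _ _ => Iff.rfl

theorem updateRow_zero_add_apply_self (i : Fin d) (r : Fin d → R)
    (ω : Matrix (Fin d) (Fin d) R) :
    (updateRow (0 : Matrix (Fin d) (Fin d) R) i r + ω) i = r + ω i := by
  ext k
  simp

theorem updateRow_zero_add_apply_of_ne {i a : Fin d} (h : a ≠ i) (r : Fin d → R)
    (ω : Matrix (Fin d) (Fin d) R) :
    (updateRow (0 : Matrix (Fin d) (Fin d) R) i r + ω) a = ω a := by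
  ext k
  simp [updateRow_ne h]

theorem minorForm_updateRow_zero_add {i j : Fin d} (h : j ≤ i) (r : Fin d → R)
    (ω : Matrix (Fin d) (Fin d) R) :
    minorForm (updateRow (0 : Matrix (Fin d) (Fin d) R) i r + ω) j = minorForm ω j :=
  minorForm_congr fun _ ha => updateRow_zero_add_apply_of_ne (ha.trans_le h).ne r ω

theorem minorForm_ne_zero_of_leadingMinor_ne_zero {j : Fin d} {ω : Matrix (Fin d) (Fin d) R}
    (h : leadingMinor ω j.isLt.le ≠ 0) : minorForm ω j ≠ 0 := by
  intro h0
  rw [← minorForm_single, h0] at h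
  exact h rfl

end RowInvariant

section Events

open IsLocalRing

variable {R : Type*} [CommRing R] [IsDomain R] [IsDiscreteValuationRing R] {d : ℕ}

/-- The set of matrices `ω` such that the linear form `minorForm ω j`, divided by its content, takes
at row `i` of `ω` a value of valuation at least `v`. It contains all `ω` with
`minorForm ω j = 0`. -/
def minorEvent (R : Type*) [CommRing R] [IsDomain R] [IsDiscreteValuationRing R] {d : ℕ}
    (j i : Fin d) (v : ℕ) : Set (Matrix (Fin d) (Fin d) R) :=
  {ω | ∀ s, (∀ r, minorForm ω j r ∈ maximalIdeal R ^ s) →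
    minorForm ω j (ω i) ∈ maximalIdeal R ^ (s + v)}

theorem rowInvariant_minorEvent {j i k : Fin d} (hj : j ≤ k) (hi : i ≠ k) (v : ℕ) :
    RowInvariant (minorEvent R j i v) k := by
  intro r ω
  simp only [minorEvent, Set.mem_ofPred_eq, minorForm_updateRow_zero_add hj,
    updateRow_zero_add_apply_of_ne hi]

/-- The set of matrices for which none of the first `n` pivots has valuation at least `v` after
division by the content of the linear form defining it. -/
def noDeepPivot (R : Type*) [CommRing R] [IsDomain R] [IsDiscreteValuationRing R] (d v n : ℕ) :
    Set (Matrix (Fin d) (Fin d) R) :=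
  {ω | ∀ j : Fin d, (j : ℕ) < n → ω ∉ minorEvent R j j v}

/-- The set of matrices for which pivot `j` has valuation at least `v` after division by the content
of the linear form defining it, and the values of this form at the next `n` rows do not attain this
content. -/
def deepColumn (R : Type*) [CommRing R] [IsDomain R] [IsDiscreteValuationRing R] {d : ℕ}
    (j : Fin d) (v n : ℕ) : Set (Matrix (Fin d) (Fin d) R) :=
  {ω | ω ∈ minorEvent R j j v ∧
    ∀ i : Fin d, j < i → (i : ℕ) < j + 1 + n → ω ∈ minorEvent R j i 1}

theorem noDeepPivot_succ (v n : ℕ) (hn : n < d) :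
    noDeepPivot R d v (n + 1) = noDeepPivot R d v n \ minorEvent R ⟨n, hn⟩ ⟨n, hn⟩ v := by
  ext ω
  simp only [noDeepPivot, Set.mem_ofPred_eq, Set.mem_sdiff, Nat.lt_succ_iff_lt_or_eq]
  constructor
  · exact fun h => ⟨fun j hj => h j (.inl hj), h ⟨n, hn⟩ (.inr rfl)⟩
  · rintro ⟨h1, h2⟩ j (hj | hj)
    · exact h1 j hj
    · obtain rfl : j = ⟨n, hn⟩ := Fin.ext hj
      exact h2

theorem deepColumn_succ (j : Fin d) (v n : ℕ) (hn : j + 1 + n < d) :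
    deepColumn R j v (n + 1) = deepColumn R j v n ∩ minorEvent R j ⟨j + 1 + n, hn⟩ 1 := by
  ext ω
  simp only [deepColumn, Set.mem_ofPred_eq, Set.mem_inter_iff]
  constructor
  · exact fun h => ⟨⟨h.1, fun i h1 h2 => h.2 i h1 (by omega)⟩,
      h.2 _ (Fin.lt_def.2 (by simp only; omega)) (by simp only; omega)⟩
  · rintro ⟨⟨h1, h2⟩, h3⟩
    refine ⟨h1, fun i hji hi => ?_⟩
    by_cases h : (i : ℕ) < j + 1 + n
    · exact h2 i hji h
    · obtain rfl : i = ⟨j + 1 + n, hn⟩ := Fin.ext (by simp only; omega)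
      exact h3

end Events

section Topology

open IsLocalRing

variable {R : Type*} [CommRing R] [TopologicalSpace R]

theorem isTopologicalRing_of_isAdic {I : Ideal R} (hR : IsAdic I) : IsTopologicalRing R := by
  rw [IsAdic] at hR
  subst hR
  exact (I.nonarchimedean).toIsTopologicalRing

theorem continuous_minorForm [IsTopologicalRing R] {d : ℕ} (j : Fin d)
    {f : Matrix (Fin d) (Fin d) R → Fin d → R} (hf : Continuous f) :
    Continuous fun ω : Matrix (Fin d) (Fin d) R => minorForm ω j (f ω) := by
  simp_rw [minorForm_apply]
  refine Continuous.matrix_det (Continuous.matrix_updateRow _ ?_ ?_)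
  · exact continuous_id.matrix_submatrix _ _
  · exact continuous_pi fun k => (continuous_apply _).comp hf

theorem measurableSet_minorEvent [IsDomain R] [IsDiscreteValuationRing R] {d : ℕ}
    (hR : IsAdic (maximalIdeal R))
    [MeasurableSpace (Matrix (Fin d) (Fin d) R)] [BorelSpace (Matrix (Fin d) (Fin d) R)]
    (j i : Fin d) (v : ℕ) : MeasurableSet (minorEvent R j i v) := by
  have := isTopologicalRing_of_isAdic hR
  have hopen := (isAdic_iff.1 hR).1
  have hclosed : ∀ s, IsClosed ((maximalIdeal R ^ s : Ideal R) : Set R) := fun s =>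
    AddSubgroup.isClosed_of_isOpen (maximalIdeal R ^ s : Ideal R).toAddSubgroup (hopen s)
  have h : minorEvent R j i v = ⋂ s : ℕ,
      ((⋂ r, {ω | minorForm ω j r ∈ maximalIdeal R ^ s})ᶜ ∪
        {ω | minorForm ω j (ω i) ∈ maximalIdeal R ^ (s + v)}) := by
    ext ω
    simp only [minorEvent, Set.mem_ofPred_eq, Set.mem_iInter, Set.mem_union, Set.mem_compl_iff,
      imp_iff_not_or]
  rw [h]
  refine MeasurableSet.iInter fun s => MeasurableSet.union (MeasurableSet.compl ?_) ?_
  · exact (isClosed_iInter fun r =>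
      (hclosed s).preimage (continuous_minorForm j continuous_const)).measurableSet
  · exact ((hopen _).preimage (continuous_minorForm j (continuous_apply i))).measurableSet

end Topology

/-! ### Probabilities of the divisibility events -/

section Probability

open IsLocalRing MeasureTheory

variable {R : Type*} [CommRing R] [IsDomain R] [IsDiscreteValuationRing R]
  [Finite (ResidueField R)] [TopologicalSpace R] {d : ℕ}
  [MeasurableSpace (Matrix (Fin d) (Fin d) R)] [BorelSpace (Matrix (Fin d) (Fin d) R)]
  (μ : Measure (Matrix (Fin d) (Fin d) R)) [μ.IsAddHaarMeasure]
  [IsProbabilityMeasure μ]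

omit [IsProbabilityMeasure μ] in
/-- Given the rows other than row `i`, the value at row `i` of a nonzero linear form that only
involves rows above `i`, divided by its content, is uniformly distributed. -/
theorem measureReal_inter_minorEvent (hR : IsAdic (maximalIdeal R)) {j i : Fin d} (hji : j ≤ i)
    (v : ℕ) {E : Set (Matrix (Fin d) (Fin d) R)} (hE : MeasurableSet E) (hEi : RowInvariant E i)
    (hae : ∀ᵐ ω ∂μ, minorForm ω j ≠ 0) :
    μ.real (E ∩ minorEvent R j i v) =
      ((Nat.card (ResidueField R) : ℝ) ^ v)⁻¹ * μ.real E := by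
  have := isTopologicalRing_of_isAdic hR
  have := finite_quotient_maximalIdeal_pow (R := R) v
  have h := mul_measure_inter_eq_of_translations μ
    (fun a : Fin d → R ⧸ maximalIdeal R ^ v =>
      updateRow (0 : Matrix (Fin d) (Fin d) R) i fun k => (a k).out)
    hE (measurableSet_minorEvent hR j i v) (fun a ω => hEi _ ω)
    (Nat.card (ResidueField R) ^ v) (by
      filter_upwards [hae] with ω hω
      rw [← card_pow_mul_card_linearForm_mem hω v (ω i)]
      simp only [minorEvent, Set.mem_ofPred_eq, minorForm_updateRow_zero_add hji,
        updateRow_zero_add_apply_self])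
  have h2 := congrArg ENNReal.toReal h
  have hq : (Nat.card (ResidueField R) : ℝ) ^ v ≠ 0 :=
    pow_ne_zero _ (Nat.cast_ne_zero.2 Nat.card_pos.ne')
  rw [ENNReal.toReal_mul] at h2
  rw [Measure.real, Measure.real, ← h2]
  simp [hq]

theorem measureReal_minorEvent (hR : IsAdic (maximalIdeal R)) {j i : Fin d} (hji : j ≤ i)
    (v : ℕ) (hae : ∀ᵐ ω ∂μ, minorForm ω j ≠ 0) :
    μ.real (minorEvent R j i v) = ((Nat.card (ResidueField R) : ℝ) ^ v)⁻¹ := by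
  simpa using measureReal_inter_minorEvent μ hR hji v MeasurableSet.univ (rowInvariant_univ i) hae

theorem ae_leadingMinor_ne_zero (hR : IsAdic (maximalIdeal R)) (n : ℕ) (hn : n ≤ d) :
    ∀ᵐ ω ∂μ, leadingMinor ω hn ≠ 0 := by
  induction n with
  | zero => simp [leadingMinor]
  | succ n ih =>
    set j : Fin d := ⟨n, hn⟩
    have hae : ∀ᵐ ω ∂μ, minorForm ω j ≠ 0 := by
      filter_upwards [ih (Nat.le_of_succ_le hn)] with ω hω
      exact minorForm_ne_zero_of_leadingMinor_ne_zero hω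
    -- A zero minor lies in events of arbitrarily small probability.
    have hsub : ∀ v, {ω : Matrix (Fin d) (Fin d) R | ¬ leadingMinor ω hn ≠ 0} ⊆
        minorEvent R j j v := by
      intro v ω hω s _
      have h0 : minorForm ω j (ω j) = 0 := (minorForm_self ω j).trans (not_not.1 hω)
      rw [h0]
      exact zero_mem _
    have hle : ∀ v : ℕ, μ.real {ω : Matrix (Fin d) (Fin d) R | ¬ leadingMinor ω hn ≠ 0} ≤
        ((Nat.card (ResidueField R) : ℝ)⁻¹) ^ v := fun v => by
      rw [inv_pow, ← measureReal_minorEvent μ hR le_rfl v hae]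
      exact measureReal_mono (hsub v)
    have hlim : Filter.Tendsto (fun v : ℕ => ((Nat.card (ResidueField R) : ℝ)⁻¹) ^ v)
        Filter.atTop (nhds 0) :=
      tendsto_pow_atTop_nhds_zero_of_lt_one (by positivity)
        (inv_lt_one_of_one_lt₀ (by exact_mod_cast Finite.one_lt_card))
    have h0 : μ.real {ω : Matrix (Fin d) (Fin d) R | ¬ leadingMinor ω hn ≠ 0} = 0 :=
      le_antisymm (ge_of_tendsto' hlim hle) measureReal_nonneg
    rw [ae_iff]
    exact (measureReal_eq_zero_iff).1 h0

theorem ae_forall_leadingMinor_ne_zero (hR : IsAdic (maximalIdeal R)) :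
    ∀ᵐ ω ∂μ, ∀ (n : ℕ) (hn : n ≤ d), leadingMinor ω hn ≠ 0 := by
  simp only [ae_all_iff]
  exact fun n hn => ae_leadingMinor_ne_zero μ hR n hn

theorem ae_minorForm_ne_zero (hR : IsAdic (maximalIdeal R)) (j : Fin d) :
    ∀ᵐ ω ∂μ, minorForm ω j ≠ 0 := by
  filter_upwards [ae_leadingMinor_ne_zero μ hR j j.isLt.le] with ω hω
  exact minorForm_ne_zero_of_leadingMinor_ne_zero hω

/-- The pivot events are independent. Measurability and invariance are carried along because the
induction conditions on the previous events. -/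
theorem measureReal_noDeepPivot (hR : IsAdic (maximalIdeal R)) (v n : ℕ) (hn : n ≤ d) :
    MeasurableSet (noDeepPivot R d v n) ∧
    (∀ i : Fin d, n ≤ i → RowInvariant (noDeepPivot R d v n) i) ∧
    μ.real (noDeepPivot R d v n) = (1 - ((Nat.card (ResidueField R) : ℝ) ^ v)⁻¹) ^ n := by
  induction n with
  | zero =>
    have : noDeepPivot R d v 0 = Set.univ := by simp [noDeepPivot]
    rw [this]
    exact ⟨MeasurableSet.univ, fun i _ => rowInvariant_univ i, by simp⟩
  | succ n ih =>
    obtain ⟨h1, h2, h3⟩ := ih (Nat.le_of_succ_le hn)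
    set j : Fin d := ⟨n, hn⟩
    have hm := measurableSet_minorEvent hR j j v
    rw [noDeepPivot_succ v n hn]
    refine ⟨h1.diff hm, fun i hi => ?_, ?_⟩
    · have hji : j < i := hi
      exact (h2 i (Nat.le_of_succ_le hi)).diff (rowInvariant_minorEvent hji.le hji.ne v)
    · have h4 := measureReal_inter_add_sdiff (μ := μ) (s := noDeepPivot R d v n) hm
      rw [measureReal_inter_minorEvent μ hR le_rfl v h1 (h2 j le_rfl)
        (ae_minorForm_ne_zero μ hR j), h3] at h4
      rw [pow_succ]
      linarith

theorem measureReal_deepColumn (hR : IsAdic (maximalIdeal R)) (j : Fin d) (v n : ℕ)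
    (hn : j + 1 + n ≤ d) :
    MeasurableSet (deepColumn R j v n) ∧
    (∀ i : Fin d, j + 1 + n ≤ i → RowInvariant (deepColumn R j v n) i) ∧
    μ.real (deepColumn R j v n) = ((Nat.card (ResidueField R) : ℝ) ^ (v + n))⁻¹ := by
  induction n with
  | zero =>
    have : deepColumn R j v 0 = minorEvent R j j v := by
      ext ω
      simp only [deepColumn, Set.mem_ofPred_eq, and_iff_left_iff_imp]
      intro _ i h1 h2
      rw [Fin.lt_def] at h1
      omega
    rw [this]
    refine ⟨measurableSet_minorEvent hR j j v, fun i hi => ?_,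
      measureReal_minorEvent μ hR le_rfl v (ae_minorForm_ne_zero μ hR j)⟩
    have hji : j < i := hi
    exact rowInvariant_minorEvent hji.le hji.ne v
  | succ n ih =>
    obtain ⟨h1, h2, h3⟩ := ih (by omega)
    have hlt : j + 1 + n < d := by omega
    set i : Fin d := ⟨j + 1 + n, hlt⟩
    have hji : j ≤ i := Fin.le_def.2 (by simp only [i]; omega)
    have hm := measurableSet_minorEvent hR j i 1
    rw [deepColumn_succ j v n hlt]
    refine ⟨h1.inter hm, fun k hk => ?_, ?_⟩
    · have hik : i < k := Fin.lt_def.2 (by simp only [i]; omega)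
      exact (h2 k (by omega)).inter (rowInvariant_minorEvent (hji.trans hik.le) hik.ne 1)
    · rw [measureReal_inter_minorEvent μ hR hji 1 h1 (h2 i le_rfl)
        (ae_minorForm_ne_zero μ hR j), h3, ← mul_inv, ← pow_add]
      congr 2
      omega

end Probability

/-! ### The valuation of the `L`-part -/

section Valuation

open IsLocalRing WithZero

variable {R : Type*} [CommRing R] [IsDomain R] [IsDiscreteValuationRing R]
  {K : Type*} [Field K] [Algebra R K] [IsFractionRing R K] {d : ℕ}

theorem valuation_algebraMap_le_exp_iff (r : R) (n : ℕ) :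
    (IsDiscreteValuationRing.maximalIdeal R).valuation K (algebraMap R K r) ≤ exp (-(n : ℤ)) ↔
      r ∈ maximalIdeal R ^ n := by
  rw [IsDedekindDomain.HeightOneSpectrum.valuation_of_algebraMap]
  exact IsDedekindDomain.HeightOneSpectrum.intValuation_le_pow_iff_mem _ r n

theorem le_negMinVal_iff {L : Matrix (Fin d) (Fin d) K} (hd : 0 < d) (h1 : ∀ i, L i i = 1)
    (v : ℤ) : v ≤ negMinVal R L ↔
      ∃ i j, exp v ≤ (IsDiscreteValuationRing.maximalIdeal R).valuation K (L i j) := by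
  have hpos : Finset.univ.sup (fun p : Fin d × Fin d =>
      (IsDiscreteValuationRing.maximalIdeal R).valuation K (L p.1 p.2)) ≠ 0 := by
    have h2 := Finset.le_sup (f := fun p : Fin d × Fin d =>
      (IsDiscreteValuationRing.maximalIdeal R).valuation K (L p.1 p.2))
      (Finset.mem_univ ((⟨0, hd⟩, ⟨0, hd⟩) : Fin d × Fin d))
    simp only [h1, map_one] at h2
    exact (zero_lt_one.trans_le h2).ne'
  rw [negMinVal, le_log_iff_exp_le hpos, Finset.le_sup_iff (by exact exp_pos)]
  simp

theorem isLU_lPart {M : Matrix (Fin d) (Fin d) K} (h : ∃ L U, IsLU M L U) :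
    ∃ U, IsLU M (lPart M) U := by
  rw [lPart, dif_pos h]
  exact h.choose_spec

omit [IsDomain R] [IsDiscreteValuationRing R] in
theorem exists_isLU_map {ω : Matrix (Fin d) (Fin d) R}
    (h : ∀ (n : ℕ) (hn : n ≤ d), leadingMinor ω hn ≠ 0) :
    ∃ L U, IsLU (ω.map (algebraMap R K)) L U :=
  exists_isLU fun n hn => by
    rw [leadingMinor_map]
    exact (map_ne_zero_iff _ (IsFractionRing.injective R K)).2 (h n hn)

omit [IsDomain R] [IsDiscreteValuationRing R] in
theorem existsUnique_isLU_map {ω : Matrix (Fin d) (Fin d) R}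
    (h : ∀ (n : ℕ) (hn : n ≤ d), leadingMinor ω hn ≠ 0) :
    ∃! LU : Matrix (Fin d) (Fin d) K × Matrix (Fin d) (Fin d) K,
      IsLU (ω.map (algebraMap R K)) LU.1 LU.2 := by
  obtain ⟨L, U, hLU⟩ := exists_isLU_map (K := K) h
  refine ⟨(L, U), hLU, fun LU' h' => Prod.ext_iff.2 (h'.unique hLU fun j => ?_)⟩
  rw [minorForm_self, leadingMinor_map]
  exact (map_ne_zero_iff _ (IsFractionRing.injective R K)).2 (h _ _)

variable {ω : Matrix (Fin d) (Fin d) R} {L U : Matrix (Fin d) (Fin d) K}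

theorem IsLU.valuation_minorForm_row (h : IsLU (ω.map (algebraMap R K)) L U) (j i : Fin d) :
    (IsDiscreteValuationRing.maximalIdeal R).valuation K
        (algebraMap R K (minorForm ω j (ω i))) =
      (IsDiscreteValuationRing.maximalIdeal R).valuation K (L i j) *
        (IsDiscreteValuationRing.maximalIdeal R).valuation K
          (algebraMap R K (minorForm ω j (ω j))) := by
  have h1 := h.minorForm_row j i
  have h2 : ∀ k, (ω.map (algebraMap R K)) k = algebraMap R K ∘ ω k := fun k => rfl
  rw [h2, h2, minorForm_map, minorForm_map] at h1
  rw [h1, map_mul]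

/-- A large entry in column `j` of `L` forces pivot `j` to be deep. -/
theorem IsLU.mem_minorEvent_of_exp_le (h : IsLU (ω.map (algebraMap R K)) L U) {j i : Fin d}
    {v : ℕ} (hv : exp (v : ℤ) ≤ (IsDiscreteValuationRing.maximalIdeal R).valuation K (L i j)) :
    ω ∈ minorEvent R j j v := by
  intro s hs
  have h1 := (valuation_algebraMap_le_exp_iff (K := K) _ s).2 (hs (ω i))
  rw [h.valuation_minorForm_row] at h1
  rw [← valuation_algebraMap_le_exp_iff (K := K)]
  have h2 := (mul_le_mul_left hv _).trans h1
  have h3 := mul_le_mul_right h2 (exp (-(v : ℤ)))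
  rw [← mul_assoc, ← exp_add, ← exp_add, neg_add_cancel, exp_zero, one_mul] at h3
  convert h3 using 2
  push_cast
  ring

/-- If pivot `j` is deep and the entry `L i j` is not large, then the value at row `i` of the linear
form attached to `j` does not attain the content of this form. -/
theorem IsLU.mem_minorEvent_one_of_lt_exp (h : IsLU (ω.map (algebraMap R K)) L U) {j i : Fin d}
    {v : ℕ} (hv : (IsDiscreteValuationRing.maximalIdeal R).valuation K (L i j) < exp (v : ℤ))
    (hj : ω ∈ minorEvent R j j v) : ω ∈ minorEvent R j i 1 := by
  intro s hs
  have h1 := (valuation_algebraMap_le_exp_iff (K := K) _ _).2 (hj s hs)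
  rw [← valuation_algebraMap_le_exp_iff (K := K), h.valuation_minorForm_row]
  have h2 : (IsDiscreteValuationRing.maximalIdeal R).valuation K (L i j) ≤ exp ((v : ℤ) - 1) := by
    rcases eq_or_ne ((IsDiscreteValuationRing.maximalIdeal R).valuation K (L i j)) 0 with h0 | h0
    · rw [h0]; exact zero_le
    · rw [← log_le_iff_le_exp h0, Int.le_sub_one_iff, log_lt_iff_lt_exp h0]
      exact hv
  refine (mul_le_mul' h2 h1).trans ?_
  rw [← exp_add, exp_le_exp]
  push_cast
  linarith

theorem VL_nonneg (hd : 0 < d) (h : ∀ (n : ℕ) (hn : n ≤ d), leadingMinor ω hn ≠ 0) :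
    0 ≤ VL K ω := by
  obtain ⟨U, hU⟩ := isLU_lPart (exists_isLU_map (K := K) h)
  rw [VL, le_negMinVal_iff hd hU.diag_one]
  refine ⟨⟨0, hd⟩, ⟨0, hd⟩, ?_⟩
  rw [hU.diag_one, map_one, exp_zero]

theorem mem_minorEvent_of_le_VL (hd : 0 < d)
    (h : ∀ (n : ℕ) (hn : n ≤ d), leadingMinor ω hn ≠ 0) {v : ℕ} (hv : (v : ℤ) ≤ VL K ω) :
    ∃ j, ω ∈ minorEvent R j j v := by
  obtain ⟨U, hU⟩ := isLU_lPart (exists_isLU_map (K := K) h)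
  rw [VL, le_negMinVal_iff hd hU.diag_one] at hv
  obtain ⟨i, j, hij⟩ := hv
  exact ⟨j, hU.mem_minorEvent_of_exp_le hij⟩

/-- The set of matrices with a deep pivot among the first `n` such that no value of the
corresponding linear form at the rows below it attains the content of the form. The index `k`
counts the pivots backwards from pivot `n - 1`. -/
def deepColumns (R : Type*) [CommRing R] [IsDomain R] [IsDiscreteValuationRing R] {d n : ℕ}
    (hn : n ≤ d) (v : ℕ) : Set (Matrix (Fin d) (Fin d) R) :=
  ⋃ k : Fin n, deepColumn R (Fin.castLE hn k.rev) v (d - n + k)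

theorem mem_union_of_VL_lt (hd : 0 < d)
    (h : ∀ (n : ℕ) (hn : n ≤ d), leadingMinor ω hn ≠ 0) {v : ℕ} (hv : VL K ω < v)
    {n : ℕ} (hn : n ≤ d) :
    ω ∈ noDeepPivot R d v n ∪ deepColumns R hn v := by
  obtain ⟨U, hU⟩ := isLU_lPart (exists_isLU_map (K := K) h)
  rw [← not_le, VL, le_negMinVal_iff hd hU.diag_one] at hv
  push Not at hv
  by_cases hω : ω ∈ noDeepPivot R d v n
  · exact Or.inl hω
  · right
    simp only [noDeepPivot, Set.mem_ofPred_eq] at hω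
    push Not at hω
    obtain ⟨j, hjn, hj⟩ := hω
    refine Set.mem_iUnion.2 ⟨(⟨j, hjn⟩ : Fin n).rev, ?_⟩
    rw [Fin.rev_rev]
    exact ⟨hj, fun i _ _ => hU.mem_minorEvent_one_of_lt_exp (hv i j) hj⟩

end Valuation

/-! ### Tail estimates -/

section Tail

open IsLocalRing MeasureTheory

variable {R : Type*} [CommRing R] [IsDomain R] [IsDiscreteValuationRing R]
  [Finite (ResidueField R)] [TopologicalSpace R] {d : ℕ}
  [MeasurableSpace (Matrix (Fin d) (Fin d) R)] [BorelSpace (Matrix (Fin d) (Fin d) R)]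
  (μ : Measure (Matrix (Fin d) (Fin d) R)) [IsProbabilityMeasure μ] [μ.IsAddHaarMeasure]

theorem measureReal_iUnion_minorEvent_le (hR : IsAdic (maximalIdeal R)) (v : ℕ) :
    μ.real (⋃ j : Fin d, minorEvent R j j v) ≤
      d * ((Nat.card (ResidueField R) : ℝ) ^ v)⁻¹ := by
  refine (measureReal_iUnion_fintype_le _).trans ?_
  simp [measureReal_minorEvent μ hR le_rfl v (ae_minorForm_ne_zero μ hR _)]

theorem measureReal_deepColumns_le (hR : IsAdic (maximalIdeal R)) {n : ℕ} (hn : n ≤ d)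
    (v : ℕ) :
    μ.real (deepColumns R hn v) ≤
      ((Nat.card (ResidueField R) : ℝ) ^ v)⁻¹ * ((Nat.card (ResidueField R) : ℝ) ^ (d - n))⁻¹ *
        (1 - (Nat.card (ResidueField R) : ℝ)⁻¹)⁻¹ := by
  have hq : (1 : ℝ) < Nat.card (ResidueField R) := by exact_mod_cast Finite.one_lt_card
  refine (measureReal_iUnion_fintype_le _).trans ?_
  have h1 : ∀ k : Fin n, μ.real (deepColumn R (Fin.castLE hn k.rev) v (d - n + k)) =
      ((Nat.card (ResidueField R) : ℝ) ^ v)⁻¹ * ((Nat.card (ResidueField R) : ℝ) ^ (d - n))⁻¹ *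
        ((Nat.card (ResidueField R) : ℝ)⁻¹) ^ (k : ℕ) := by
    intro k
    rw [(measureReal_deepColumn μ hR _ v _ _).2.2, pow_add, pow_add, mul_inv, mul_inv, inv_pow,
      mul_assoc]
    simp only [Fin.val_castLE, Fin.val_rev]
    omega
  simp_rw [h1]
  rw [← Finset.mul_sum, Fin.sum_univ_eq_sum_range
    (fun k => ((Nat.card (ResidueField R) : ℝ)⁻¹) ^ k) n]
  have hlt := inv_lt_one_of_one_lt₀ hq
  have hnn : (0 : ℝ) ≤ (Nat.card (ResidueField R) : ℝ)⁻¹ := by positivity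
  rw [← tsum_geometric_of_lt_one hnn hlt]
  gcongr
  exact (summable_geometric_of_lt_one hnn hlt).sum_le_tsum _ fun k _ => by positivity

theorem mul_inv_pow_le_rpow_neg {q D ℓ : ℝ} (hq : 1 < q) (hD : 0 < D) {v : ℕ}
    (hv : Real.logb q D + ℓ ≤ v) : D * (q ^ v)⁻¹ ≤ q ^ (-ℓ) := by
  have hq0 : 0 < q := by linarith
  have h1 : D = q ^ Real.logb q D := (Real.rpow_logb hq0 hq.ne' hD).symm
  rw [h1, ← Real.rpow_natCast, ← Real.rpow_neg hq0.le, ← Real.rpow_add hq0]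
  exact Real.rpow_le_rpow_of_exponent_le hq.le (by linarith)

/-- With `y = ℓ * log q`, this follows from `1 + y + y ^ 2 / 2 ≤ exp y` and `2 * y ≤ 1 + y ^ 2`. -/
theorem exp_neg_rpow_add_le {q ℓ : ℝ} (hq : 2 ≤ q) (hℓ : 0 < ℓ) :
    Real.exp (- q ^ ℓ + (ℓ + 1) / q) ≤ q ^ (-ℓ) := by
  have hq0 : 0 < q := by linarith
  have hlog2 : (1 : ℝ) / 2 < Real.log 2 := by linarith [Real.log_two_gt_d9]
  have hlog : (1 : ℝ) / 2 ≤ Real.log q := hlog2.le.trans (Real.log_le_log (by norm_num) hq)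
  have hy : 0 < Real.log q * ℓ := by positivity
  rw [Real.rpow_def_of_pos hq0, Real.rpow_def_of_pos hq0, Real.exp_le_exp]
  have h1 := Real.quadratic_le_exp_of_nonneg hy.le
  have h2 : (ℓ + 1) / q ≤ Real.log q * ℓ + 1 / 2 := by
    rw [div_le_iff₀ hq0]
    nlinarith [mul_le_mul hlog hq (by norm_num) (by linarith), mul_pos hℓ hq0]
  nlinarith [sq_nonneg (Real.log q * ℓ - 1)]

/-- The numerical estimate for the lower tail, where `m` pivots are discarded. The hypothesis on `v`
means `q ^ ℓ < q ^ (-v) * d`; the first summand is then bounded by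
`exp (-q ^ (-v) * (d - m)) ≤ exp (-q ^ ℓ + (ℓ + 1) / q)`, the second one through `q ^ ℓ ≤ q ^ m`. -/
theorem lower_tail_le {q ℓ : ℝ} (hq : 2 ≤ q) (hℓ : 0 < ℓ) {d v m : ℕ} (hd : 0 < d)
    (hv : 1 ≤ v) (hvd : v < Real.logb q d - ℓ) (hm : ℓ ≤ m) (hm' : m < ℓ + 1) :
    m ≤ d ∧ (1 - (q ^ v)⁻¹) ^ (d - m) + (q ^ v)⁻¹ * (q ^ m)⁻¹ * (1 - q⁻¹)⁻¹ ≤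
      q ^ (-ℓ) * (q / (q - 1)) := by
  have hq0 : 0 < q := by linarith
  have hd' : (0 : ℝ) < d := Nat.cast_pos.2 hd
  have hlogd : q ^ Real.logb q d = d := Real.rpow_logb hq0 (by linarith) hd'
  -- As `v ≥ 1`, the hypothesis on `v` gives `d ≥ q ^ (1 + ℓ) ≥ 2 + ℓ > m`.
  have hmd : m ≤ d := by
    have h1 : q ^ (1 + ℓ) ≤ d := by
      rw [← hlogd]
      refine Real.rpow_le_rpow_of_exponent_le (by linarith) ?_
      have : (1 : ℝ) ≤ v := by exact_mod_cast hv
      linarith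
    have h2 : 1 + (1 + ℓ) * 1 ≤ (1 + 1 : ℝ) ^ (1 + ℓ) :=
      one_add_mul_self_le_rpow_one_add (by norm_num) (by linarith)
    have h3 : (1 + 1 : ℝ) ^ (1 + ℓ) ≤ q ^ (1 + ℓ) :=
      Real.rpow_le_rpow (by norm_num) (by linarith) (by linarith)
    have h4 : (m : ℝ) ≤ d := by linarith
    exact_mod_cast h4
  refine ⟨hmd, ?_⟩
  have hp0 : 0 < (q ^ v)⁻¹ := by positivity
  have hpq : (q ^ v)⁻¹ ≤ q⁻¹ := by
    apply inv_anti₀ hq0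
    exact le_self_pow₀ (by linarith) (by omega)
  have hq1 : q⁻¹ ≤ 1 := inv_le_one_of_one_le₀ (by linarith)
  have hpd : q ^ ℓ ≤ (q ^ v)⁻¹ * d := by
    rw [← hlogd, ← Real.rpow_natCast, ← Real.rpow_neg hq0.le, ← Real.rpow_add hq0]
    exact Real.rpow_le_rpow_of_exponent_le (by linarith) (by linarith)
  have h1 : (1 - (q ^ v)⁻¹) ^ (d - m) ≤ q ^ (-ℓ) := by
    refine le_trans ?_ (exp_neg_rpow_add_le hq hℓ)
    have h2 : 1 - (q ^ v)⁻¹ ≤ Real.exp (-(q ^ v)⁻¹) := by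
      linarith [Real.add_one_le_exp (-(q ^ v)⁻¹)]
    refine (pow_le_pow_left₀ (by linarith) h2 _).trans ?_
    rw [← Real.exp_nat_mul, Real.exp_le_exp, Nat.cast_sub hmd]
    have h3 : (q ^ v)⁻¹ * m ≤ (ℓ + 1) / q := by
      rw [div_eq_mul_inv, mul_comm (ℓ + 1)]
      exact mul_le_mul hpq hm'.le (Nat.cast_nonneg m) (by positivity)
    linarith
  have h2 : (q ^ m)⁻¹ ≤ q ^ (-ℓ) := by
    rw [← Real.rpow_natCast, ← Real.rpow_neg hq0.le]
    exact Real.rpow_le_rpow_of_exponent_le (by linarith) (by linarith)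
  have hqm : 0 < q - 1 := by linarith
  have h3 : (1 - q⁻¹)⁻¹ = q / (q - 1) := by
    field_simp
  have h4 : (q ^ v)⁻¹ * (q ^ m)⁻¹ * (1 - q⁻¹)⁻¹ ≤ q⁻¹ * q ^ (-ℓ) * (q / (q - 1)) := by
    rw [h3]
    gcongr
  have h5 : q ^ (-ℓ) * (q / (q - 1)) = q ^ (-ℓ) + q⁻¹ * q ^ (-ℓ) * (q / (q - 1)) := by
    field_simp
    ring
  linarith

end Tail

end RandomLU

theorem mainTheorem2 {R : Type*} [CommRing R] [IsDomain R] [IsDiscreteValuationRing R]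
    [IsAdicComplete (IsLocalRing.maximalIdeal R) R]
    [Finite (IsLocalRing.ResidueField R)]
    [TopologicalSpace R] (hR : IsAdic (IsLocalRing.maximalIdeal R))
    {K : Type*} [Field K] [Algebra R K] [IsFractionRing R K]
    (d : ℕ) (hd : 0 < d) (q : ℕ) (hq : q = Nat.card (IsLocalRing.ResidueField R))
    [MeasurableSpace (Matrix (Fin d) (Fin d) R)] [BorelSpace (Matrix (Fin d) (Fin d) R)]
    (μ : MeasureTheory.Measure (Matrix (Fin d) (Fin d) R))
    [MeasureTheory.IsProbabilityMeasure μ] [μ.IsAddHaarMeasure] :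
    (∀ᵐ ω ∂μ, ∃! LU : Matrix (Fin d) (Fin d) K × Matrix (Fin d) (Fin d) K,
      RandomLU.IsLU (ω.map (algebraMap R K)) LU.1 LU.2) ∧
    ∀ ℓ : ℝ, 0 < ℓ →
      μ {ω | ℓ + 1 / 2 < |(RandomLU.VL K ω : ℝ) - (Real.logb q d - 1 / 2)|} ≤
        ENNReal.ofReal
          ((q : ℝ) / ((q : ℝ) - 1) * (q : ℝ) ^ (-ℓ) * (2 + ℓ * Real.log q)) := by
  have hae := RandomLU.ae_forall_leadingMinor_ne_zero μ hR
  refine ⟨?_, fun ℓ hℓ => ?_⟩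
  · filter_upwards [hae] with ω hω
    exact RandomLU.existsUnique_isLU_map hω
  have hq2 : (2 : ℝ) ≤ q := by
    rw [hq]
    exact_mod_cast (Finite.one_lt_card : 1 < Nat.card (IsLocalRing.ResidueField R))
  have hd' : (1 : ℝ) ≤ d := by exact_mod_cast hd
  have hlogd : 0 ≤ Real.logb q d := Real.logb_nonneg (by linarith) hd'
  -- The upper tail is `u ≤ VL`, the lower one is `VL < v`.
  set u : ℕ := ⌈Real.logb q d + ℓ⌉₊ with hu
  set v : ℕ := ⌈Real.logb q d - 1 - ℓ⌉₊ with hv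
  have hup : μ.real (⋃ j, RandomLU.minorEvent R j j u) ≤ (q : ℝ) ^ (-ℓ) := by
    refine (RandomLU.measureReal_iUnion_minorEvent_le μ hR u).trans ?_
    rw [← hq]
    exact RandomLU.mul_inv_pow_le_rpow_neg (by linarith) (by linarith) (Nat.le_ceil _)
  have hupper : ∀ ω : Matrix (Fin d) (Fin d) R,
      (∀ (n : ℕ) (hn : n ≤ d), RandomLU.leadingMinor ω hn ≠ 0) →
      Real.logb q d + ℓ < RandomLU.VL K ω → ω ∈ ⋃ j, RandomLU.minorEvent R j j u := by
    intro ω hω h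
    refine Set.mem_iUnion.2 (RandomLU.mem_minorEvent_of_le_VL (K := K) hd hω ?_)
    rw [hu, Int.natCast_ceil_eq_ceil (by linarith), Int.ceil_le]
    exact h.le
  obtain ⟨T, hT, hlower⟩ : ∃ T : Set (Matrix (Fin d) (Fin d) R),
      μ.real T ≤ (q : ℝ) ^ (-ℓ) * (q / (q - 1)) ∧
      ∀ ω : Matrix (Fin d) (Fin d) R,
        (∀ (n : ℕ) (hn : n ≤ d), RandomLU.leadingMinor ω hn ≠ 0) →
        RandomLU.VL K ω < Real.logb q d - 1 - ℓ → ω ∈ T := by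
    rcases Nat.eq_zero_or_pos v with hv0 | hv0
    · refine ⟨∅, ?_, fun ω hω h => ?_⟩
      · have : (0 : ℝ) < q - 1 := by linarith
        simp only [MeasureTheory.measureReal_empty]
        positivity
      · have h1 : Real.logb q d - 1 - ℓ ≤ 0 := Nat.ceil_eq_zero.1 hv0
        have h2 : (0 : ℝ) ≤ RandomLU.VL K ω := by
          exact_mod_cast RandomLU.VL_nonneg (K := K) hd hω
        linarith
    · have hpos : 0 < Real.logb q d - 1 - ℓ := Nat.ceil_pos.1 hv0
      have hvlt : (v : ℝ) < Real.logb q d - ℓ := by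
        have := Nat.ceil_lt_add_one hpos.le
        linarith
      -- The last `⌈ℓ⌉` pivots are discarded: too few rows lie below them.
      obtain ⟨hmd, hle⟩ := RandomLU.lower_tail_le hq2 hℓ hd hv0 hvlt (Nat.le_ceil ℓ)
        (Nat.ceil_lt_add_one hℓ.le)
      refine ⟨_, le_trans ?_ hle, fun ω hω h =>
        RandomLU.mem_union_of_VL_lt (K := K) (v := v) hd hω ?_ (Nat.sub_le d ⌈ℓ⌉₊)⟩
      · refine (MeasureTheory.measureReal_union_le _ _).trans (add_le_add ?_ ?_)
        · rw [(RandomLU.measureReal_noDeepPivot μ hR v _ (Nat.sub_le _ _)).2.2, hq]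
        · have h1 := RandomLU.measureReal_deepColumns_le μ hR (Nat.sub_le d ⌈ℓ⌉₊) v
          rwa [← hq, Nat.sub_sub_self hmd] at h1
      · rw [hv, Int.natCast_ceil_eq_ceil hpos.le, Int.lt_ceil]
        exact h
  have hsub : {ω | ℓ + 1 / 2 < |(RandomLU.VL K ω : ℝ) - (Real.logb q d - 1 / 2)|} ≤ᵐ[μ]
      ((⋃ j, RandomLU.minorEvent R j j u) ∪ T : Set (Matrix (Fin d) (Fin d) R)) := by
    filter_upwards [hae] with ω hω h
    have h' : ℓ + 1 / 2 < |(RandomLU.VL K ω : ℝ) - (Real.logb q d - 1 / 2)| := h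
    rcases lt_abs.1 h' with h1 | h1
    · exact Or.inl (hupper ω hω (by linarith))
    · exact Or.inr (hlower ω hω (by linarith))
  refine (MeasureTheory.measure_mono_ae hsub).trans ?_
  rw [← MeasureTheory.ofReal_measureReal]
  refine ENNReal.ofReal_le_ofReal ((MeasureTheory.measureReal_union_le _ _).trans
    ((add_le_add hup hT).trans ?_))
  have hq1 : (0 : ℝ) < q - 1 := by linarith
  have hx : 0 < (q : ℝ) ^ (-ℓ) := Real.rpow_pos_of_pos (by linarith) _
  have hone : 1 ≤ (q : ℝ) / (q - 1) := (one_le_div hq1).2 (by linarith)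
  have hlog : 0 ≤ ℓ * Real.log q := mul_nonneg hℓ.le (Real.log_nonneg (by linarith))
  have h1 : 0 ≤ (q : ℝ) / (q - 1) * q ^ (-ℓ) * (ℓ * Real.log q) := by positivity
  nlinarith [mul_le_mul_of_nonneg_left hone hx.le]
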